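/- Let $R$ be an associative ring with identity, let $n\ge 0$ be an integer, and let $M$ be a right $R$-module of projective dimension at most $n$. Then $M$ admits a projective resolution $\cdots\to P_1\to P_0\to M\to 0$ whose term $P_n$ is finitely generated if and only if $\operatorname{Ext}^n_R(M,-)$ preserves direct sums of copies of $R$, that is, for every set $I$ the canonical homomorphism $$\bigoplus_{i\in I}\operatorname{Ext}^n_R(M,R)\to\operatorname{Ext}^n_R\Bigl(M,\bigoplus_{i\in I}R\Bigr)$$ induced by the canonical injections $R\to\bigoplus_{i\in I}R$ is an isomorphism. If these equivalent conditions hold, then the functors $\operatorname{Ext}^n_R(M,-)$ and $-\otimes_R\operatorname{Ext}^n_R(M,R)$ from right $R$-modules to abelian groups are naturally isomorphic, where $\operatorname{Ext}^n_R(M,R)$ is a left $R$-module through the left multiplications of $R$ on itself. -/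

import Mathlib

universe u

open CategoryTheory Abelian
open scoped TensorProduct DirectSum MulOpposite

namespace RightModuleExt

section Ext

variable {R : Type u} [Ring R]

variable (R) in
/-- The ring `R` as a right module over itself, that is, as an `Rᵐᵒᵖ`-module with
`MulOpposite.op r • x = x * r`. -/
abbrev regular : ModuleCat.{u} Rᵐᵒᵖ := ModuleCat.of Rᵐᵒᵖ R

/-- Left multiplication `x ↦ r * x`, an endomorphism of the right module `R`. -/
def leftMul (r : R) : regular R ⟶ regular R :=
  ModuleCat.ofHom
    { toFun := fun x => r * x
      map_add' := mul_add r
      map_smul' := fun s x => (mul_assoc r x s.unop).symm }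

theorem leftMul_one : leftMul (1 : R) = 𝟙 (regular R) := by
  ext
  exact one_mul _

theorem leftMul_mul (r s : R) : leftMul (r * s) = leftMul s ≫ leftMul r := by
  ext
  exact mul_assoc r s _

theorem leftMul_add (r s : R) : leftMul (r + s) = leftMul r + leftMul s := by
  ext
  exact add_mul r s _

theorem leftMul_zero : leftMul (0 : R) = 0 := by
  ext
  exact zero_mul _

/-- The left `R`-module structure on `Extⁿ(M, R)`: the scalar `r` acts as `Extⁿ(M, r * -)`. -/
noncomputable instance leftModule (M : ModuleCat.{u} Rᵐᵒᵖ) (n : ℕ) :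
    Module R (Ext M (regular R) n) where
  smul r x := x.comp (Ext.mk₀ (leftMul r)) (add_zero n)
  one_smul x := by
    change x.comp (Ext.mk₀ (leftMul 1)) (add_zero n) = x
    rw [leftMul_one, Ext.comp_mk₀_id]
  mul_smul r s x := by
    change x.comp (Ext.mk₀ (leftMul (r * s))) (add_zero n) =
      (x.comp (Ext.mk₀ (leftMul s)) (add_zero n)).comp (Ext.mk₀ (leftMul r)) (add_zero n)
    rw [leftMul_mul, Ext.comp_assoc_of_third_deg_zero, Ext.mk₀_comp_mk₀]
  smul_zero r := Ext.zero_comp M n (Ext.mk₀ (leftMul r)) n (add_zero n)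
  smul_add r x y := Ext.add_comp x y (Ext.mk₀ (leftMul r)) (add_zero n)
  add_smul r s x := by
    change x.comp (Ext.mk₀ (leftMul (r + s))) (add_zero n) =
      x.comp (Ext.mk₀ (leftMul r)) (add_zero n) + x.comp (Ext.mk₀ (leftMul s)) (add_zero n)
    rw [leftMul_add, Ext.mk₀_add, Ext.comp_add]
  zero_smul x := by
    change x.comp (Ext.mk₀ (leftMul 0)) (add_zero n) = 0
    rw [leftMul_zero, Ext.mk₀_zero, Ext.comp_zero]

open Classical in
/-- The canonical homomorphism `⨁ i, Extⁿ(M, N i) → Extⁿ(M, ⨁ i, N i)`, induced by the maps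
`Extⁿ(M, uᵢ)`, where `uᵢ : N i → ⨁ i, N i` are the canonical injections. -/
noncomputable def directSumComparison (M : ModuleCat.{u} Rᵐᵒᵖ) (n : ℕ) {I : Type u}
    (N : I → ModuleCat.{u} Rᵐᵒᵖ) :
    (⨁ i, Ext M (N i) n) →+ Ext M (ModuleCat.of Rᵐᵒᵖ (⨁ i, N i)) n :=
  DirectSum.toAddMonoid fun i =>
    (Ext.mk₀ (Y := ModuleCat.of Rᵐᵒᵖ (⨁ i, N i))
      (ModuleCat.ofHom (DirectSum.lof Rᵐᵒᵖ I (fun i => N i) i))).postcomp M (add_zero n)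

/-- `Extⁿ(M, -)` preserves direct sums of copies of `R`: for every index set `I` the canonical
homomorphism `Extⁿ(M, R)^(I) → Extⁿ(M, R^(I))` is an isomorphism. -/
def PreservesDirectSumsOfCopies (M : ModuleCat.{u} Rᵐᵒᵖ) (n : ℕ) : Prop :=
  ∀ I : Type u, Function.Bijective (directSumComparison M n fun _ : I => regular R)

/-- `M` has a projective resolution whose term in degree `n` is finitely generated. -/
def HasResolutionFinitelyGeneratedIn (M : ModuleCat.{u} Rᵐᵒᵖ) (n : ℕ) : Prop :=
  ∃ P : ProjectiveResolution M, Module.Finite Rᵐᵒᵖ (P.complex.X n)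

end Ext

section Tensor

variable {R : Type u} [Ring R] (E : Type u) [AddCommGroup E]

/-- The homomorphism `f ⊗ E` on the tensor products over `ℤ`. -/
def preMap {X Y : ModuleCat.{u} Rᵐᵒᵖ} (f : X ⟶ Y) : (X ⊗[ℤ] E) →+ (Y ⊗[ℤ] E) :=
  (LinearMap.rTensor E f.hom.toAddMonoidHom.toIntLinearMap).toAddMonoidHom

theorem preMap_tmul {X Y : ModuleCat.{u} Rᵐᵒᵖ} (f : X ⟶ Y) (x : X) (e : E) :
    preMap E f (x ⊗ₜ[ℤ] e) = f.hom x ⊗ₜ[ℤ] e := rfl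

variable [Module R E]

/-- The subgroup of `X ⊗[ℤ] E` generated by the elements `(x r) ⊗ e - x ⊗ (r e)`. -/
def balancing (X : ModuleCat.{u} Rᵐᵒᵖ) : AddSubgroup (X ⊗[ℤ] E) :=
  AddSubgroup.closure
    {t | ∃ (x : X) (r : R) (e : E), t = (MulOpposite.op r • x) ⊗ₜ[ℤ] e - x ⊗ₜ[ℤ] (r • e)}

/-- The tensor product `X ⊗_R E` of a right `R`-module `X` and a left `R`-module `E` over a not
necessarily commutative ring `R`. -/
abbrev Tensor (X : ModuleCat.{u} Rᵐᵒᵖ) : Type u := (X ⊗[ℤ] E) ⧸ balancing E X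

theorem balancing_le_comap {X Y : ModuleCat.{u} Rᵐᵒᵖ} (f : X ⟶ Y) :
    balancing E X ≤ (balancing E Y).comap (preMap E f) := by
  rw [balancing, AddSubgroup.closure_le]
  rintro _ ⟨x, r, e, rfl⟩
  refine AddSubgroup.subset_closure ⟨f.hom x, r, e, ?_⟩
  rw [map_sub, preMap_tmul, preMap_tmul, map_smul]

/-- The homomorphism `f ⊗_R E : X ⊗_R E → Y ⊗_R E`, `x ⊗ e ↦ f x ⊗ e`. -/
def tensorMap {X Y : ModuleCat.{u} Rᵐᵒᵖ} (f : X ⟶ Y) : Tensor E X →+ Tensor E Y :=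
  QuotientAddGroup.map _ _ (preMap E f) (balancing_le_comap E f)

theorem tensorMap_mk_tmul {X Y : ModuleCat.{u} Rᵐᵒᵖ} (f : X ⟶ Y) (x : X) (e : E) :
    tensorMap E f (QuotientAddGroup.mk (x ⊗ₜ[ℤ] e)) =
      QuotientAddGroup.mk (f.hom x ⊗ₜ[ℤ] e) := rfl

theorem tensor_hom_ext {X : ModuleCat.{u} Rᵐᵒᵖ} {A : Type u} [AddCommGroup A]
    {f g : Tensor E X →+ A}
    (h : ∀ (x : X) (e : E), f (QuotientAddGroup.mk (x ⊗ₜ[ℤ] e)) =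
      g (QuotientAddGroup.mk (x ⊗ₜ[ℤ] e))) : f = g := by
  ext t
  induction t using TensorProduct.induction_on with
  | zero => simp
  | tmul x e => exact h x e
  | add s t hs ht =>
    rw [map_add, map_add, hs, ht]

/-- The functor `- ⊗_R E` from right `R`-modules to abelian groups. -/
def tensorFunctor : ModuleCat.{u} Rᵐᵒᵖ ⥤ AddCommGrpCat.{u} where
  obj X := AddCommGrpCat.of (Tensor E X)
  map f := AddCommGrpCat.ofHom (tensorMap E f)
  map_id X := by
    refine congrArg AddCommGrpCat.ofHom
      (tensor_hom_ext E (g := AddMonoidHom.id (Tensor E X)) fun x e => rfl)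
  map_comp {X Y Z} f g := by
    refine congrArg AddCommGrpCat.ofHom
      (tensor_hom_ext E (g := (tensorMap E g).comp (tensorMap E f)) fun x e => rfl)

end Tensor

end RightModuleExt

/-! The comparison map is always injective, and by `mem_range_directSumComparison_iff` its image
consists of the classes fixed by truncation to some finite `F ⊆ I`. If `P_n` is finitely generated,
a cocycle `P_n ⟶ R^(I)` lands in a finite partial sum, so every class is fixed by a truncation.

The converse is by induction on `n`. For `n = 0`, a section of a free cover of the projective `M`
factors through a finite partial sum. For `n ≥ 2`, dimension shifting passes to the first syzygy.
For `n = 1`, `Hom(P₀, -)` does not vanish, so the identity of the syzygy `K` factors through a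
finite free `Q` only up to maps extending to `P₀`; `exists_shortExact_of_retraction` then exchanges
`K` for `Q`.

For the last claim, `Extⁿ(M, -)` is right exact because `Extⁿ⁺¹(M, -) = 0`. The canonical map `X ⊗
Extⁿ(M, R) → Extⁿ(M, X)` is bijective for free `X` by preservation, and free covers carry this to
all `X`. -/

namespace RightModuleExt

/-! ### Direct sums and their finite truncations -/

section Truncation

variable {R : Type u} [Ring R] {I : Type u} (N : I → ModuleCat.{u} Rᵐᵒᵖ)

/-- The direct sum `⨁ i, N i` as an object of the category of right modules. -/
abbrev directSum : ModuleCat.{u} Rᵐᵒᵖ := ModuleCat.of Rᵐᵒᵖ (⨁ i, N i)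

open Classical in
/-- The canonical injection `N i ⟶ ⨁ i, N i`. -/
noncomputable def directSumι (i : I) : N i ⟶ directSum N :=
  ModuleCat.ofHom (DirectSum.lof Rᵐᵒᵖ I (fun i => N i) i)

/-- The canonical projection `⨁ i, N i ⟶ N i`. -/
def directSumπ (i : I) : directSum N ⟶ N i :=
  ModuleCat.ofHom (DirectSum.component Rᵐᵒᵖ I (fun i => N i) i)

open Classical in
/-- The projection of `⨁ i, N i` onto the partial sum over the finite set `F`. -/
noncomputable def truncation (F : Finset I) : directSum N ⟶ directSum N :=
  ModuleCat.ofHom (DFinsupp.filterLinearMap Rᵐᵒᵖ (fun i => N i) (· ∈ F))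

variable {N}

open Classical in
theorem truncation_apply (F : Finset I) (v : ⨁ i, N i) (i : I) :
    ((truncation N F).hom v : ⨁ i, N i) i = if i ∈ F then v i else 0 :=
  DFinsupp.filter_apply (β := fun i => N i) (· ∈ F) i v

open Classical in
theorem directSumι_apply (i : I) (x : N i) (j : I) :
    ((directSumι N i).hom x : ⨁ i, N i) j = if h : i = j then h ▸ x else 0 := by
  change (DirectSum.of (fun i => N i) i x) j = _
  rw [DirectSum.of_apply]

theorem directSumι_π_same (i : I) : directSumι N i ≫ directSumπ N i = 𝟙 (N i) := by
  ext x
  change ((directSumι N i).hom x : ⨁ i, N i) i = x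
  rw [directSumι_apply, dif_pos rfl]

theorem directSumι_π_of_ne {i j : I} (h : i ≠ j) : directSumι N i ≫ directSumπ N j = 0 := by
  ext x
  change ((directSumι N i).hom x : ⨁ i, N i) j = 0
  rw [directSumι_apply, dif_neg h]

theorem directSum_hom_ext {X : ModuleCat.{u} Rᵐᵒᵖ} {f g : X ⟶ directSum N}
    (h : ∀ i, f ≫ directSumπ N i = g ≫ directSumπ N i) : f = g := by
  ext x i
  exact congrArg (fun k => k.hom x) (h i)

theorem truncation_π_of_mem {F : Finset I} {i : I} (h : i ∈ F) :
    truncation N F ≫ directSumπ N i = directSumπ N i := by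
  ext v
  exact (truncation_apply F v i).trans (if_pos h)

theorem truncation_π_of_notMem {F : Finset I} {i : I} (h : i ∉ F) :
    truncation N F ≫ directSumπ N i = 0 := by
  ext v
  exact (truncation_apply F v i).trans (if_neg h)

theorem truncation_comp_of_subset {F G : Finset I} (h : F ⊆ G) :
    truncation N F ≫ truncation N G = truncation N F := by
  refine directSum_hom_ext fun i => ?_
  by_cases hG : i ∈ G
  · rw [Category.assoc, truncation_π_of_mem hG]
  · rw [Category.assoc, truncation_π_of_notMem hG, Limits.comp_zero,
      truncation_π_of_notMem fun hF => hG (h hF)]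

theorem directSumι_truncation {F : Finset I} {i : I} (h : i ∈ F) :
    directSumι N i ≫ truncation N F = directSumι N i := by
  refine directSum_hom_ext fun j => ?_
  by_cases hj : j ∈ F
  · rw [Category.assoc, truncation_π_of_mem hj]
  · rw [Category.assoc, truncation_π_of_notMem hj, Limits.comp_zero,
      directSumι_π_of_ne fun hij : i = j => hj (hij ▸ h)]

theorem truncation_empty : truncation N ∅ = 0 :=
  directSum_hom_ext fun i => by
    rw [truncation_π_of_notMem (Finset.notMem_empty i), Limits.zero_comp]

open Classical in
theorem truncation_insert {F : Finset I} {i : I} (h : i ∉ F) :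
    truncation N (insert i F) = directSumπ N i ≫ directSumι N i + truncation N F := by
  refine directSum_hom_ext fun j => ?_
  rw [Preadditive.add_comp, Category.assoc]
  by_cases hij : i = j
  · subst hij
    rw [truncation_π_of_mem (Finset.mem_insert_self _ _), truncation_π_of_notMem h,
      directSumι_π_same, Category.comp_id, add_zero]
  · rw [directSumι_π_of_ne hij, Limits.comp_zero, zero_add]
    by_cases hj : j ∈ F
    · rw [truncation_π_of_mem hj, truncation_π_of_mem (Finset.mem_insert_of_mem hj)]
    · rw [truncation_π_of_notMem hj, truncation_π_of_notMem]
      rintro hj'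
      rcases Finset.mem_insert.1 hj' with rfl | hj'
      exacts [hij rfl, hj hj']

/-- The union of the supports of the images of finitely many generators serves as `F`. -/
theorem exists_comp_truncation_eq_self {X : ModuleCat.{u} Rᵐᵒᵖ} [Module.Finite Rᵐᵒᵖ X]
    (f : X ⟶ directSum N) : ∃ F : Finset I, f ≫ truncation N F = f := by
  classical
  obtain ⟨k, s, hs⟩ := Module.Finite.exists_fin (R := Rᵐᵒᵖ) (M := X)
  refine ⟨Finset.univ.biUnion fun j => DFinsupp.support (f.hom (s j) : ⨁ i, N i), ?_⟩
  refine ModuleCat.hom_ext (LinearMap.ext_on_range hs fun j => ?_)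
  refine DFinsupp.ext fun i => ?_
  refine (truncation_apply _ _ i).trans ?_
  split_ifs with hi
  · rfl
  · by_contra h
    exact hi (Finset.mem_biUnion.2 ⟨j, Finset.mem_univ j, DFinsupp.mem_support_iff.2 (Ne.symm h)⟩)

end Truncation

/-! ### The image of the comparison map, and the forward implication -/

section Comparison

variable {R : Type u} [Ring R] {M : ModuleCat.{u} Rᵐᵒᵖ} {n : ℕ} {I : Type u}
  {N : I → ModuleCat.{u} Rᵐᵒᵖ}

open Classical in
theorem directSumComparison_of (i : I) (x : Ext M (N i) n) :
    directSumComparison M n N (DirectSum.of _ i x) =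
      x.comp (Ext.mk₀ (directSumι N i)) (add_zero n) :=
  DirectSum.toAddMonoid_of _ _ _

/-- Postcomposing with the `i`-th projection recovers the `i`-th coordinate. -/
theorem directSumComparison_injective : Function.Injective (directSumComparison M n N) := by
  classical
  have key (i : I) : ((Ext.mk₀ (directSumπ N i)).postcomp M (add_zero n)).comp
      (directSumComparison M n N) = DFinsupp.evalAddMonoidHom i := by
    refine DirectSum.addHom_ext fun j x => ?_
    change (directSumComparison M n N (DirectSum.of (fun i => Ext M (N i) n) j x)).comp
      (Ext.mk₀ (directSumπ N i)) (add_zero n) =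
        (DirectSum.of (fun i => Ext M (N i) n) j x) i
    rw [directSumComparison_of, Ext.comp_assoc_of_third_deg_zero, Ext.mk₀_comp_mk₀]
    by_cases h : j = i
    · subst h
      rw [directSumι_π_same, Ext.comp_mk₀_id, DirectSum.of_eq_same]
    · rw [directSumι_π_of_ne h, Ext.mk₀_zero, Ext.comp_zero, DirectSum.of_eq_of_ne _ _ _ (Ne.symm h)]
  intro z w h
  refine DFinsupp.ext fun i => ?_
  have := congrArg ((Ext.mk₀ (directSumπ N i)).postcomp M (add_zero n)) h
  exact (DFunLike.congr_fun (key i) z).symm.trans (this.trans (DFunLike.congr_fun (key i) w))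

theorem mem_range_directSumComparison_iff (α : Ext M (directSum N) n) :
    α ∈ (directSumComparison M n N).range ↔
      ∃ F : Finset I, α.comp (Ext.mk₀ (truncation N F)) (add_zero n) = α := by
  classical
  constructor
  · rintro ⟨z, rfl⟩
    induction z using DirectSum.induction_on with
    | zero => exact ⟨∅, by rw [map_zero, Ext.zero_comp]⟩
    | of i x =>
      refine ⟨{i}, ?_⟩
      rw [directSumComparison_of, Ext.comp_assoc_of_third_deg_zero, Ext.mk₀_comp_mk₀,
        directSumι_truncation (Finset.mem_singleton_self i)]
    | add x y hx hy =>
      obtain ⟨F, hF⟩ := hx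
      obtain ⟨G, hG⟩ := hy
      refine ⟨F ∪ G, ?_⟩
      rw [map_add, Ext.add_comp]
      congr 1
      · rw [← hF, Ext.comp_assoc_of_third_deg_zero, Ext.mk₀_comp_mk₀,
          truncation_comp_of_subset Finset.subset_union_left]
      · rw [← hG, Ext.comp_assoc_of_third_deg_zero, Ext.mk₀_comp_mk₀,
          truncation_comp_of_subset Finset.subset_union_right]
  -- A truncation is a finite sum of maps `directSumπ N i ≫ directSumι N i`, each of which sends `α`
  -- into the image.
  · rintro ⟨F, hF⟩
    rw [← hF]
    clear hF
    induction F using Finset.induction_on with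
    | empty =>
      rw [truncation_empty, Ext.mk₀_zero, Ext.comp_zero]
      exact zero_mem _
    | insert i F hi ih =>
      rw [truncation_insert hi, Ext.mk₀_add, Ext.comp_add]
      refine add_mem ⟨DirectSum.of _ i (α.comp (Ext.mk₀ (directSumπ N i)) (add_zero n)), ?_⟩ ih
      rw [directSumComparison_of, Ext.comp_assoc_of_third_deg_zero, Ext.mk₀_comp_mk₀]

variable (M n) in
theorem preservesDirectSumsOfCopies_iff :
    PreservesDirectSumsOfCopies M n ↔
      ∀ (I : Type u) (α : Ext M (directSum fun _ : I => regular R) n), ∃ F : Finset I,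
        α.comp (Ext.mk₀ (truncation (fun _ : I => regular R) F)) (add_zero n) = α := by
  refine forall_congr' fun I => ?_
  simp only [Function.Bijective, directSumComparison_injective, true_and,
    ← mem_range_directSumComparison_iff]
  rfl

theorem HasResolutionFinitelyGeneratedIn.preservesDirectSumsOfCopies
    (h : HasResolutionFinitelyGeneratedIn M n) : PreservesDirectSumsOfCopies M n := by
  rw [preservesDirectSumsOfCopies_iff]
  intro I α
  obtain ⟨P, hP⟩ := h
  obtain ⟨f, hf, rfl⟩ := P.extMk_surjective α (n + 1) rfl
  obtain ⟨F, hF⟩ := exists_comp_truncation_eq_self f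
  refine ⟨F, ?_⟩
  rw [P.extMk_comp_mk₀]
  simp only [hF]

end Comparison

/-! ### Splicing projective resolutions -/

section Splice

variable {C : Type*} [Category C] [Abelian C] {S : ShortComplex C}

/-- A projective resolution of `S.X₃` is obtained from a projective resolution of `S.X₁` by
splicing with a short exact sequence `0 ⟶ S.X₁ ⟶ S.X₂ ⟶ S.X₃ ⟶ 0` with `S.X₂` projective. -/
theorem exists_projectiveResolution_of_shortExact (hS : S.ShortExact) [Projective S.X₂]
    (P : ProjectiveResolution S.X₁) :
    ∃ Q : ProjectiveResolution S.X₃, ∀ n, Q.complex.X (n + 1) = P.complex.X n := by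
  have := hS.mono_f
  have := hS.epi_g
  obtain ⟨p, hp, hexact₀, hepi⟩ : ∃ (p : P.complex.X 0 ⟶ S.X₁) (hp : P.complex.d 1 0 ≫ p = 0),
      (ShortComplex.mk _ _ hp).Exact ∧ Epi p :=
    ⟨P.π.f 0, P.complex_d_comp_π_f_zero, P.exact₀, inferInstanceAs (Epi (P.π.f 0))⟩
  have hw : P.complex.d 1 0 ≫ p ≫ S.f = 0 := by
    rw [← Category.assoc, hp, Limits.zero_comp]
  let K : ChainComplex C ℕ := P.complex.augment (p ≫ S.f) hw
  have hK : K.d 1 0 ≫ S.g = 0 := by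
    change (p ≫ S.f) ≫ S.g = 0
    rw [Category.assoc, S.zero, Limits.comp_zero]
  -- The new differential `p ≫ S.f` has the same image as `S.f`, since `p` is epi.
  have hzero : (ShortComplex.mk (K.d 1 0) S.g hK).Exact := by
    let φ : ShortComplex.mk (K.d 1 0) S.g hK ⟶ S :=
      { τ₁ := p
        τ₂ := 𝟙 _
        τ₃ := 𝟙 _
        comm₁₂ := (Category.comp_id _).symm
        comm₂₃ := (Category.id_comp _).trans (Category.comp_id _).symm }
    have : Epi φ.τ₁ := hepi
    have : IsIso φ.τ₂ := inferInstanceAs (IsIso (𝟙 _))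
    have : Mono φ.τ₃ := inferInstanceAs (Mono (𝟙 _))
    exact (ShortComplex.exact_iff_of_epi_of_isIso_of_mono φ).2 hS.exact
  have hsucc (n : ℕ) : K.ExactAt (n + 1) := by
    rw [HomologicalComplex.exactAt_iff' _ (n + 2) (n + 1) n (by simp) (by simp)]
    cases n with
    | zero =>
      -- Since `S.f` is mono, `p ≫ S.f` has the same kernel as `p`.
      let φ : ShortComplex.mk _ _ hp ⟶
          K.sc' 2 1 0 :=
        { τ₁ := 𝟙 _
          τ₂ := 𝟙 _
          τ₃ := S.f
          comm₁₂ := (Category.id_comp _).trans (Category.comp_id _).symm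
          comm₂₃ := Category.id_comp _ }
      have : Epi φ.τ₁ := inferInstanceAs (Epi (𝟙 _))
      have : IsIso φ.τ₂ := inferInstanceAs (IsIso (𝟙 _))
      have : Mono φ.τ₃ := inferInstanceAs (Mono S.f)
      exact (ShortComplex.exact_iff_of_epi_of_isIso_of_mono φ).1 hexact₀
    | succ n => exact P.exact_succ n
  have hπ : ((K.toSingle₀Equiv S.X₃).symm ⟨S.g, hK⟩).f 0 = S.g :=
    ChainComplex.toSingle₀Equiv_symm_apply_f_zero (C := K) S.g hK
  refine ⟨
    { complex := K
      projective := fun n => match n with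
        | 0 => inferInstanceAs (Projective S.X₂)
        | n + 1 => P.projective n
      π := (K.toSingle₀Equiv _).symm ⟨S.g, hK⟩
      quasiIso := ⟨fun n => ?_⟩ }, fun n => rfl⟩
  cases n with
  | zero =>
    rw [ChainComplex.quasiIsoAt₀_iff, ShortComplex.quasiIso_iff_of_zeros']
    · refine (ShortComplex.exact_and_epi_g_iff_of_iso ?_).2
        (⟨hzero, ‹Epi S.g›⟩ : (ShortComplex.mk (K.d 1 0) S.g hK).Exact ∧ Epi S.g)
      exact ShortComplex.isoMk (Iso.refl _) (Iso.refl _) (Iso.refl _)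
        ((Category.id_comp _).trans (Category.comp_id _).symm)
        ((Category.id_comp _).trans (hπ.symm.trans (Category.comp_id _).symm))
    all_goals rfl
  | succ n =>
    rw [quasiIsoAt_iff_exactAt']
    · exact hsucc n
    · exact ChainComplex.exactAt_succ_single_obj _ _

end Splice

/-! ### From preservation of direct sums to a finitely generated term -/

section FiniteTerm

variable {R : Type u} [Ring R]

variable (R) in
/-- The right module `R` is isomorphic to the left module `Rᵐᵒᵖ` over `Rᵐᵒᵖ`. -/
def regularEquiv : Rᵐᵒᵖ ≃ₗ[Rᵐᵒᵖ] R where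
  toFun := MulOpposite.unop
  invFun := MulOpposite.op
  map_add' _ _ := rfl
  map_smul' _ _ := rfl
  left_inv _ := rfl
  right_inv _ := rfl

theorem truncation_eq_sum {I : Type u} {N : I → ModuleCat.{u} Rᵐᵒᵖ} (F : Finset I) :
    truncation N F = ∑ i ∈ F, directSumπ N i ≫ directSumι N i := by
  classical
  induction F using Finset.induction_on with
  | empty => rw [truncation_empty, Finset.sum_empty]
  | insert i F hi ih => rw [truncation_insert hi, Finset.sum_insert hi, ih]

theorem exists_truncation_factorization {I : Type u} (F : Finset I) :
    ∃ (Q : ModuleCat.{u} Rᵐᵒᵖ) (a : directSum (fun _ : I => regular R) ⟶ Q)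
      (b : Q ⟶ directSum fun _ : I => regular R),
      Module.Finite Rᵐᵒᵖ Q ∧ Module.Projective Rᵐᵒᵖ Q ∧ a ≫ b = truncation _ F := by
  refine ⟨ModuleCat.of Rᵐᵒᵖ (F → Rᵐᵒᵖ),
    ModuleCat.ofHom (LinearMap.pi fun i : F =>
      (regularEquiv R).symm.toLinearMap ∘ₗ (directSumπ (fun _ : I => regular R) i).hom),
    ∑ i : F, ModuleCat.ofHom ((regularEquiv R).toLinearMap ∘ₗ LinearMap.proj i) ≫
      directSumι (fun _ : I => regular R) i,
    inferInstanceAs (Module.Finite Rᵐᵒᵖ (F → Rᵐᵒᵖ)),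
    inferInstanceAs (Module.Projective Rᵐᵒᵖ (F → Rᵐᵒᵖ)), ?_⟩
  rw [truncation_eq_sum, Preadditive.comp_sum]
  exact Finset.sum_coe_sort F fun i =>
    directSumπ (fun _ : I => regular R) i ≫ directSumι (fun _ : I => regular R) i

/-- The homomorphism `R ⟶ X` of right modules with `1 ↦ x`. -/
def fromRegular {X : ModuleCat.{u} Rᵐᵒᵖ} (x : X) : regular R ⟶ X :=
  ModuleCat.ofHom
    { toFun := fun r => MulOpposite.op r • x
      map_add' := fun r s => add_smul (MulOpposite.op r) (MulOpposite.op s) x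
      map_smul' := fun s r => mul_smul s (MulOpposite.op r) x }

theorem exists_epi_directSum (X : ModuleCat.{u} Rᵐᵒᵖ) :
    ∃ (I : Type u) (p : directSum (fun _ : I => regular R) ⟶ X), Epi p := by
  classical
  refine ⟨X, ModuleCat.ofHom (DirectSum.toModule Rᵐᵒᵖ X X fun x => (fromRegular x).hom), ?_⟩
  rw [ModuleCat.epi_iff_surjective]
  intro x
  refine ⟨(directSumι (fun _ : X => regular R) x).hom (1 : R), ?_⟩
  refine (DirectSum.toModule_lof Rᵐᵒᵖ (M := fun _ : X => R) x 1).trans ?_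
  exact one_smul _ x

/-- Over a short exact sequence `0 ⟶ K ⟶ P ⟶ M ⟶ 0` whose left map `i` satisfies
`𝟙 = i ≫ g + a ≫ b` with `a : K ⟶ Q`, one can replace `K` by `Q`: the pushout of `i` along `a`
is a direct summand of `P × Q`. -/
theorem exists_shortExact_of_retraction {S : ShortComplex (ModuleCat.{u} Rᵐᵒᵖ)}
    (hS : S.ShortExact) [Projective S.X₂] {Q : ModuleCat.{u} Rᵐᵒᵖ} [Module.Projective Rᵐᵒᵖ Q]
    (g : S.X₂ ⟶ S.X₁) (a : S.X₁ ⟶ Q) (b : Q ⟶ S.X₁) (h : S.f ≫ g + a ≫ b = 𝟙 S.X₁) :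
    ∃ T : ShortComplex (ModuleCat.{u} Rᵐᵒᵖ), T.ShortExact ∧ Projective T.X₂ ∧
      T.X₁ = Q ∧ T.X₃ = S.X₃ := by
  have hP : Module.Projective Rᵐᵒᵖ S.X₂ := (IsProjective.iff_projective _).2 inferInstance
  -- The pushout is the cokernel of `i`; by `h`, `r` is a retraction of `i`.
  let i : S.X₁ →ₗ[Rᵐᵒᵖ] S.X₂ × Q := S.f.hom.prod (-a.hom)
  let r : S.X₂ × Q →ₗ[Rᵐᵒᵖ] S.X₁ := g.hom.coprod (-b.hom)
  have hri (x : S.X₁) : r (i x) = x := by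
    have := congrArg (fun k => k.hom x) h
    simpa [i, r] using this
  have hgi (x : S.X₁) : (S.g.hom ∘ₗ LinearMap.fst Rᵐᵒᵖ S.X₂ Q) (i x) = 0 :=
    S.moduleCat_zero_apply x
  let T : ShortComplex (ModuleCat.{u} Rᵐᵒᵖ) :=
    ShortComplex.mk (X₁ := Q) (X₂ := ModuleCat.of Rᵐᵒᵖ ((S.X₂ × Q) ⧸ LinearMap.range i))
      (X₃ := S.X₃)
      (ModuleCat.ofHom ((LinearMap.range i).mkQ ∘ₗ LinearMap.inr Rᵐᵒᵖ S.X₂ Q))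
      (ModuleCat.ofHom ((LinearMap.range i).liftQ (S.g.hom ∘ₗ LinearMap.fst Rᵐᵒᵖ S.X₂ Q)
        (by rintro _ ⟨x, rfl⟩; exact hgi x)))
      (by ext q; exact map_zero S.g.hom)
  refine ⟨T, ModuleCat.shortComplex_shortExact T ?_ ?_ ?_, ?_, rfl, rfl⟩
  · intro c
    constructor
    · induction c using Submodule.Quotient.induction_on with
      | H v =>
        obtain ⟨p, q⟩ := v
        intro hp
        obtain ⟨x, hx⟩ := (S.moduleCat_exact_iff.1 hS.exact) p hp
        -- With `p = S.f x`, subtracting `i x` moves `(p, q)` to `(0, q + a x)`.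
        refine ⟨q + a.hom x, (Submodule.Quotient.eq _).2 ⟨-x, Prod.ext ?_ ?_⟩⟩
        · change S.f.hom (-x) = 0 - p
          rw [map_neg, zero_sub]
          exact congrArg _ hx
        · change -a.hom (-x) = q + a.hom x - q
          rw [map_neg, neg_neg, add_sub_cancel_left]
    · rintro ⟨q, rfl⟩
      exact map_zero S.g.hom
  · refine (injective_iff_map_eq_zero _).2 fun q hq => ?_
    obtain ⟨x, hx⟩ := (Submodule.Quotient.mk_eq_zero _).1 hq
    have hx0 : x = 0 := hS.moduleCat_injective_f <|
      (congrArg Prod.fst hx).trans (map_zero S.f.hom).symm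
    have := congrArg Prod.snd hx
    rw [hx0, map_zero] at this
    exact this.symm
  · intro m
    obtain ⟨p, hp⟩ := hS.moduleCat_surjective_g m
    exact ⟨Submodule.Quotient.mk (p, 0), hp⟩
  · refine (IsProjective.iff_projective (R := Rᵐᵒᵖ) ((S.X₂ × Q) ⧸ LinearMap.range i)).1 ?_
    -- The map `1 - i r` kills the range of `i` and descends to a section of the quotient map.
    refine Module.Projective.of_split
      ((LinearMap.range i).liftQ (LinearMap.id - i ∘ₗ r) ?_) (LinearMap.range i).mkQ ?_
    · rintro _ ⟨x, rfl⟩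
      simp [hri]
    · refine Submodule.linearMap_qext _ (LinearMap.ext fun v => ?_)
      refine (Submodule.Quotient.eq _).2 ⟨-(r v), ?_⟩
      simp

theorem exists_shortExact_of_projective (M : ModuleCat.{u} Rᵐᵒᵖ) :
    ∃ S : ShortComplex (ModuleCat.{u} Rᵐᵒᵖ), S.ShortExact ∧ Projective S.X₂ ∧ S.X₃ = M :=
  ⟨ShortComplex.mk (Limits.kernel.ι (Projective.π M)) (Projective.π M)
      (Limits.kernel.condition _),
    ShortComplex.ShortExact.mk' (ShortComplex.exact_kernel _) inferInstance
      (inferInstanceAs (Epi (Projective.π M))),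
    inferInstanceAs (Projective (Projective.over M)), rfl⟩

/-- If `Extⁿ⁺¹(M, -)` preserves direct sums of copies of `R`, then every class in `Extⁿ` of
the first syzygy factors through a finite partial sum, up to a class that vanishes in
`Extⁿ⁺¹(M, -)`. -/
theorem PreservesDirectSumsOfCopies.exists_truncation_of_shortExact
    {S : ShortComplex (ModuleCat.{u} Rᵐᵒᵖ)} (hS : S.ShortExact) {n : ℕ}
    (h : PreservesDirectSumsOfCopies S.X₃ (n + 1)) {I : Type u}
    (y : Ext S.X₁ (directSum fun _ : I => regular R) n) :
    ∃ (F : Finset I) (z : Ext S.X₂ (directSum fun _ : I => regular R) n),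
      (Ext.mk₀ S.f).comp z (zero_add n) + y.comp (Ext.mk₀ (truncation _ F)) (add_zero n) = y := by
  obtain ⟨F, hF⟩ := (preservesDirectSumsOfCopies_iff _ _).1 h I
    (hS.extClass.comp y (add_comm 1 n))
  -- The connecting map kills the difference between `y` and its truncation, so that difference
  -- comes from `S.X₂`.
  obtain ⟨z, hz⟩ := Ext.contravariant_sequence_exact₁ hS _
    (y - y.comp (Ext.mk₀ (truncation _ F)) (add_zero n)) (add_comm 1 n) (by
      rw [sub_eq_add_neg, Ext.comp_add, Ext.comp_neg, ← Ext.comp_assoc_of_third_deg_zero, hF,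
        add_neg_cancel])
  exact ⟨F, z, by rw [hz, sub_add_cancel]⟩

/-- A section of a free cover, viewed as a class in `Ext⁰`, is fixed by a finite truncation, so `M`
is a quotient of a finite free module. -/
theorem PreservesDirectSumsOfCopies.finite_of_projective {M : ModuleCat.{u} Rᵐᵒᵖ} [Projective M]
    (h : PreservesDirectSumsOfCopies M 0) : Module.Finite Rᵐᵒᵖ M := by
  obtain ⟨I, p, hp⟩ := exists_epi_directSum M
  obtain ⟨F, hF⟩ := (preservesDirectSumsOfCopies_iff _ _).1 h I
    (Ext.mk₀ (Projective.factorThru (𝟙 M) p))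
  rw [Ext.mk₀_comp_mk₀] at hF
  obtain ⟨Q, a, b, hQ, -, hab⟩ := exists_truncation_factorization (R := R) F
  have hs : Projective.factorThru (𝟙 M) p ≫ a ≫ b = Projective.factorThru (𝟙 M) p := by
    rw [hab]
    exact (Ext.mk₀_bijective _ _).1 hF
  refine Module.Finite.of_surjective (b ≫ p).hom fun x =>
    ⟨(Projective.factorThru (𝟙 M) p ≫ a).hom x, ?_⟩
  have := congrArg (fun k : M ⟶ _ => (k ≫ p).hom x) hs
  simp only [Projective.factorThru_comp] at this
  exact this

theorem PreservesDirectSumsOfCopies.hasResolutionFinitelyGeneratedIn {n : ℕ} :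
    ∀ {M : ModuleCat.{u} Rᵐᵒᵖ}, HasProjectiveDimensionLE M n →
      PreservesDirectSumsOfCopies M n → HasResolutionFinitelyGeneratedIn M n := by
  induction n with
  | zero =>
    intro M hM h
    have : Projective M := (projective_iff_hasProjectiveDimensionLE_zero _).2 hM
    exact ⟨ProjectiveResolution.self M, h.finite_of_projective⟩
  | succ n ih =>
    intro M hM h
    obtain ⟨S, hS, hS₂, rfl⟩ := exists_shortExact_of_projective M
    have hK : HasProjectiveDimensionLE S.X₁ n := (hS.hasProjectiveDimensionLT_X₃_iff n hS₂).1 hM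
    cases n with
    | zero =>
      have : Projective S.X₁ := (projective_iff_hasProjectiveDimensionLE_zero _).2 hK
      obtain ⟨I, p, hp⟩ := exists_epi_directSum S.X₁
      let s := Projective.factorThru (𝟙 S.X₁) p
      -- Composing the resulting decomposition of `s` with `p` gives the identity of `S.X₁` in the
      -- form needed for the exchange.
      obtain ⟨F, z, hz⟩ := h.exists_truncation_of_shortExact hS (Ext.mk₀ s)
      obtain ⟨g, rfl⟩ := (Ext.mk₀_bijective _ _).2 z
      obtain ⟨Q, a, b, hQ, hQ', hab⟩ := exists_truncation_factorization (R := R) F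
      rw [Ext.mk₀_comp_mk₀, Ext.mk₀_comp_mk₀, ← Ext.mk₀_add, ← hab] at hz
      obtain ⟨T, hT, hT₂, rfl, hT₃⟩ := exists_shortExact_of_retraction hS (g ≫ p) (s ≫ a) (b ≫ p)
        (by
          have := congrArg (· ≫ p) ((Ext.mk₀_bijective _ _).1 hz)
          simpa [s, Preadditive.add_comp] using this)
      have : Projective T.X₁ := (IsProjective.iff_projective _).1 hQ'
      rw [← hT₃]
      obtain ⟨P, hP⟩ := exists_projectiveResolution_of_shortExact hT (ProjectiveResolution.self _)
      exact ⟨P, by rw [hP]; exact hQ⟩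
    | succ n =>
      obtain ⟨P, hP⟩ := ih hK <| (preservesDirectSumsOfCopies_iff _ _).2 fun I y => by
        obtain ⟨F, z, hz⟩ := h.exists_truncation_of_shortExact hS y
        -- Here `z` has positive degree `n + 1` and `S.X₂` is projective, so the correction term
        -- vanishes.
        rw [z.eq_zero_of_hasProjectiveDimensionLT 1 (Nat.le_add_left 1 n), Ext.comp_zero,
          zero_add] at hz
        exact ⟨F, hz⟩
      obtain ⟨P', hP'⟩ := exists_projectiveResolution_of_shortExact hS P
      exact ⟨P', by rw [hP']; exact hP⟩

end FiniteTerm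

/-! ### The natural isomorphism with the tensor functor -/

section TensorComparison

variable {R : Type u} [Ring R]

theorem fromRegular_add {X : ModuleCat.{u} Rᵐᵒᵖ} (x y : X) :
    fromRegular (x + y) = fromRegular x + fromRegular y := by
  ext
  exact smul_add _ x y

theorem leftMul_fromRegular {X : ModuleCat.{u} Rᵐᵒᵖ} (x : X) (r : R) :
    leftMul r ≫ fromRegular x = fromRegular (MulOpposite.op r • x) := by
  ext
  exact mul_smul _ (MulOpposite.op r) x

theorem fromRegular_comp {X Y : ModuleCat.{u} Rᵐᵒᵖ} (x : X) (f : X ⟶ Y) :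
    fromRegular x ≫ f = fromRegular (f.hom x) := by
  ext
  exact map_smul f.hom _ x

theorem fromRegular_regular (r : R) : fromRegular (X := regular R) r = leftMul r := rfl

variable (M : ModuleCat.{u} Rᵐᵒᵖ) (n : ℕ)

/-- The homomorphism `X ⊗[ℤ] Extⁿ(M, R) → Extⁿ(M, X)` that sends `x ⊗ e` to the image of `e`
under `Extⁿ(M, r ↦ x r)`. -/
noncomputable def preTensorComparison (X : ModuleCat.{u} Rᵐᵒᵖ) :
    (X ⊗[ℤ] Ext M (regular R) n) →+ Ext M X n :=
  TensorProduct.liftAddHom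
    (AddMonoidHom.mk' (fun x => (Ext.mk₀ (fromRegular x)).postcomp M (add_zero n)) fun x y => by
      ext e
      change e.comp (Ext.mk₀ (fromRegular (x + y))) (add_zero n) = _
      rw [fromRegular_add, Ext.mk₀_add, Ext.comp_add]
      rfl)
    fun r x e => by rw [map_zsmul, map_zsmul, AddMonoidHom.zsmul_apply]

theorem preTensorComparison_tmul {X : ModuleCat.{u} Rᵐᵒᵖ} (x : X) (e : Ext M (regular R) n) :
    preTensorComparison M n X (x ⊗ₜ[ℤ] e) = e.comp (Ext.mk₀ (fromRegular x)) (add_zero n) := rfl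

/-- The canonical homomorphism `X ⊗_R Extⁿ(M, R) → Extⁿ(M, X)`. -/
noncomputable def tensorComparison (X : ModuleCat.{u} Rᵐᵒᵖ) :
    Tensor (R := R) (Ext M (regular R) n) X →+ Ext M X n :=
  QuotientAddGroup.lift _ (preTensorComparison M n X) <| by
    rw [balancing, AddSubgroup.closure_le]
    rintro _ ⟨x, r, e, rfl⟩
    change preTensorComparison M n X _ = 0
    rw [map_sub, preTensorComparison_tmul, preTensorComparison_tmul, sub_eq_zero,
      ← leftMul_fromRegular, ← Ext.mk₀_comp_mk₀, ← Ext.comp_assoc_of_third_deg_zero]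
    rfl

theorem tensorComparison_mk_tmul {X : ModuleCat.{u} Rᵐᵒᵖ} (x : X) (e : Ext M (regular R) n) :
    tensorComparison M n X (QuotientAddGroup.mk (x ⊗ₜ[ℤ] e)) =
      e.comp (Ext.mk₀ (fromRegular x)) (add_zero n) := rfl

theorem tensorComparison_naturality {X Y : ModuleCat.{u} Rᵐᵒᵖ} (f : X ⟶ Y)
    (t : Tensor (R := R) (Ext M (regular R) n) X) :
    tensorComparison M n Y (tensorMap _ f t) =
      (tensorComparison M n X t).comp (Ext.mk₀ f) (add_zero n) := by
  refine DFunLike.congr_fun (f := (tensorComparison M n Y).comp (tensorMap _ f))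
    (g := ((Ext.mk₀ f).postcomp M (add_zero n)).comp (tensorComparison M n X))
    (tensor_hom_ext (R := R) _ fun x e => ?_) t
  change tensorComparison M n Y (QuotientAddGroup.mk (f.hom x ⊗ₜ[ℤ] e)) =
    (tensorComparison M n X (QuotientAddGroup.mk (x ⊗ₜ[ℤ] e))).comp (Ext.mk₀ f) (add_zero n)
  rw [tensorComparison_mk_tmul, tensorComparison_mk_tmul, Ext.comp_assoc_of_third_deg_zero,
    Ext.mk₀_comp_mk₀, fromRegular_comp]

theorem tensorMap_comp_apply (E : Type u) [AddCommGroup E] [Module R E]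
    {X Y Z : ModuleCat.{u} Rᵐᵒᵖ} (f : X ⟶ Y) (g : Y ⟶ Z) (t : Tensor (R := R) E X) :
    tensorMap E g (tensorMap E f t) = tensorMap E (f ≫ g) t :=
  DFunLike.congr_fun (f := (tensorMap E g).comp (tensorMap E f)) (g := tensorMap E (f ≫ g))
    (tensor_hom_ext (R := R) E fun _ _ => rfl) t

theorem tensorMap_zero_apply (E : Type u) [AddCommGroup E] [Module R E]
    {X Y : ModuleCat.{u} Rᵐᵒᵖ} (t : Tensor (R := R) E X) :
    tensorMap E (0 : X ⟶ Y) t = 0 :=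
  DFunLike.congr_fun (g := (0 : Tensor (R := R) E X →+ Tensor (R := R) E Y))
    (tensor_hom_ext (R := R) E fun _ e =>
      congrArg QuotientAddGroup.mk (TensorProduct.zero_tmul _ e)) t

theorem tensor_induction (E : Type u) [AddCommGroup E] [Module R E]
    {X : ModuleCat.{u} Rᵐᵒᵖ} {H : AddSubgroup (Tensor (R := R) E X)}
    (h : ∀ (x : X) (e : E), (QuotientAddGroup.mk (x ⊗ₜ[ℤ] e) : Tensor (R := R) E X) ∈ H)
    (t : Tensor (R := R) E X) : t ∈ H := by
  obtain ⟨t, rfl⟩ := QuotientAddGroup.mk_surjective t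
  induction t using TensorProduct.induction_on with
  | zero => exact zero_mem H
  | tmul x e => exact h x e
  | add s t hs ht => exact add_mem hs ht

theorem tensorMap_surjective (E : Type u) [AddCommGroup E] [Module R E]
    {X Y : ModuleCat.{u} Rᵐᵒᵖ} (f : X ⟶ Y) (hf : Function.Surjective f.hom) :
    Function.Surjective (tensorMap (R := R) E f) := by
  intro t
  refine tensor_induction (R := R) E (H := (tensorMap (R := R) E f).range) (fun y e => ?_) t
  obtain ⟨x, rfl⟩ := hf y
  exact ⟨QuotientAddGroup.mk (x ⊗ₜ[ℤ] e), rfl⟩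

variable {M n}

/-- The direct sum comparison factors as `σ`, sending `e` in the `i`-th summand to `eᵢ ⊗ e`,
followed by the tensor comparison. As `σ` is onto and the composite bijective, both factors are
bijective. -/
theorem PreservesDirectSumsOfCopies.tensorComparison_bijective_directSum
    (h : PreservesDirectSumsOfCopies M n) (I : Type u) :
    Function.Bijective (tensorComparison M n (directSum fun _ : I => regular R)) := by
  classical
  let E := Ext M (regular R) n
  let X := directSum fun _ : I => regular R
  let σ : (⨁ _ : I, E) →+ Tensor (R := R) E X :=
    DirectSum.toAddMonoid fun i => (QuotientAddGroup.mk' (balancing (R := R) E X)).comp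
      (TensorProduct.mk ℤ X E
        ((directSumι (fun _ : I => regular R) i).hom (1 : R))).toAddMonoidHom
  have hσ (i : I) (e : E) : σ (DirectSum.of _ i e) = QuotientAddGroup.mk
      (((directSumι (fun _ : I => regular R) i).hom (1 : R) : X) ⊗ₜ[ℤ] e) :=
    DirectSum.toAddMonoid_of _ _ _
  have hcomp : (tensorComparison M n X).comp σ =
      directSumComparison M n fun _ : I => regular R := by
    refine DirectSum.addHom_ext fun i e => ?_
    rw [AddMonoidHom.comp_apply, hσ, tensorComparison_mk_tmul, directSumComparison_of,
      ← fromRegular_comp, fromRegular_regular, leftMul_one, Category.id_comp]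
  have hbal (x : X) (r : R) (e : E) :
      (QuotientAddGroup.mk ((MulOpposite.op r • x) ⊗ₜ[ℤ] e) : Tensor (R := R) E X) =
        QuotientAddGroup.mk (x ⊗ₜ[ℤ] (r • e)) := by
    rw [← sub_eq_zero, ← QuotientAddGroup.mk_sub, QuotientAddGroup.eq_zero_iff]
    exact AddSubgroup.subset_closure ⟨x, r, e, rfl⟩
  have hsurj : Function.Surjective σ := by
    refine tensor_induction (R := R) E (H := σ.range) fun x e => ?_
    induction (x : ⨁ _ : I, R) using DirectSum.induction_on with
    | zero =>
      rw [TensorProduct.zero_tmul]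
      exact zero_mem _
    | of i r =>
      -- Balancing gives `(eᵢ r) ⊗ e = eᵢ ⊗ (r e)`.
      refine ⟨DirectSum.of _ i (r • e), ?_⟩
      rw [hσ, ← hbal, ← map_smul]
      exact congrArg (fun x : X => (QuotientAddGroup.mk (x ⊗ₜ[ℤ] e) : Tensor (R := R) E X))
        (congrArg (directSumι (fun _ : I => regular R) i).hom (one_mul r))
    | add x y hx hy =>
      rw [TensorProduct.add_tmul]
      exact add_mem hx hy
  have hbij : Function.Bijective (tensorComparison M n X ∘ σ) := by
    have := h I
    rw [← hcomp] at this
    exact this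
  exact (Function.Bijective.of_comp_iff _ ⟨hbij.1.of_comp, hsurj⟩).1 hbij

/-- If `M` has projective dimension at most `n`, then `Extⁿ(M, -)` preserves epimorphisms. -/
theorem ext_postcomp_surjective [HasProjectiveDimensionLE M n]
    {S : ShortComplex (ModuleCat.{u} Rᵐᵒᵖ)} (hS : S.ShortExact) (y : Ext M S.X₃ n) :
    ∃ x : Ext M S.X₂ n, x.comp (Ext.mk₀ S.g) (add_zero n) = y :=
  Ext.covariant_sequence_exact₃ M hS y rfl
    (Ext.eq_zero_of_hasProjectiveDimensionLT _ (n + 1) le_rfl)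

theorem exists_shortExact_directSum (X : ModuleCat.{u} Rᵐᵒᵖ) :
    ∃ (I : Type u) (S : ShortComplex (ModuleCat.{u} Rᵐᵒᵖ)), S.ShortExact ∧
      S.X₂ = (directSum fun _ : I => regular R) ∧ S.X₃ = X := by
  obtain ⟨I, p, hp⟩ := exists_epi_directSum X
  exact ⟨I, ShortComplex.mk (Limits.kernel.ι p) p (Limits.kernel.condition p),
    ShortComplex.ShortExact.mk' (ShortComplex.exact_kernel p) inferInstance hp, rfl, rfl⟩

theorem PreservesDirectSumsOfCopies.tensorComparison_surjective [HasProjectiveDimensionLE M n]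
    (h : PreservesDirectSumsOfCopies M n) (X : ModuleCat.{u} Rᵐᵒᵖ) :
    Function.Surjective (tensorComparison M n X) := by
  obtain ⟨I, S, hS, hS₂, rfl⟩ := exists_shortExact_directSum X
  have hbij := h.tensorComparison_bijective_directSum I
  rw [← hS₂] at hbij
  intro y
  obtain ⟨x, rfl⟩ := ext_postcomp_surjective hS y
  obtain ⟨t, rfl⟩ := hbij.2 x
  exact ⟨tensorMap _ S.g t, tensorComparison_naturality M n S.g t⟩

/-- A chase over a free cover of `X`: lift `t` to the cover; its image in `Extⁿ` comes from the
kernel, where surjectivity is already known, so the lift itself comes from the kernel and dies in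
`X`. -/
theorem PreservesDirectSumsOfCopies.tensorComparison_injective [HasProjectiveDimensionLE M n]
    (h : PreservesDirectSumsOfCopies M n) (X : ModuleCat.{u} Rᵐᵒᵖ) :
    Function.Injective (tensorComparison M n X) := by
  obtain ⟨I, S, hS, hS₂, rfl⟩ := exists_shortExact_directSum X
  have hbij := h.tensorComparison_bijective_directSum I
  rw [← hS₂] at hbij
  refine (injective_iff_map_eq_zero _).2 fun t ht => ?_
  obtain ⟨t, rfl⟩ := tensorMap_surjective _ S.g hS.moduleCat_surjective_g t
  rw [tensorComparison_naturality] at ht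
  obtain ⟨y, hy⟩ := Ext.covariant_sequence_exact₂ M hS _ ht
  obtain ⟨k, rfl⟩ := h.tensorComparison_surjective S.X₁ y
  rw [← tensorComparison_naturality] at hy
  rw [← hbij.1 hy, tensorMap_comp_apply, S.zero, tensorMap_zero_apply]

theorem PreservesDirectSumsOfCopies.nonempty_iso_tensorFunctor [HasProjectiveDimensionLE M n]
    (h : PreservesDirectSumsOfCopies M n) :
    Nonempty (extFunctorObj M n ≅ tensorFunctor (R := R) (Ext M (regular R) n)) := by
  refine ⟨(NatIso.ofComponents (fun X => AddEquiv.toAddCommGrpIso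
    (X := AddCommGrpCat.of (Tensor (R := R) (Ext M (regular R) n) X))
    (Y := AddCommGrpCat.of (Ext M X n)) (AddEquiv.ofBijective (tensorComparison M n X)
      ⟨h.tensorComparison_injective X, h.tensorComparison_surjective X⟩)) fun {X Y} f => ?_).symm⟩
  ext t
  exact tensorComparison_naturality M n f t

end TensorComparison

end RightModuleExt

theorem corollary2p8 {R : Type u} [Ring R] (M : ModuleCat.{u} Rᵐᵒᵖ) (n : ℕ)
    (hM : HasProjectiveDimensionLE M n) :
    (RightModuleExt.HasResolutionFinitelyGeneratedIn M n ↔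
      RightModuleExt.PreservesDirectSumsOfCopies M n) ∧
    (RightModuleExt.PreservesDirectSumsOfCopies M n →
      Nonempty (extFunctorObj M n ≅
        RightModuleExt.tensorFunctor (R := R) (Ext M (RightModuleExt.regular R) n))) :=
  ⟨⟨fun h => h.preservesDirectSumsOfCopies, fun h => h.hasResolutionFinitelyGeneratedIn hM⟩,
    fun h => h.nonempty_iso_tensorFunctor⟩
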